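/- Let $m\ge 2$ and $n\ge 1$, let $S^k\subset\mathbb R^{k+1}$ be the unit sphere with its round metric, and let $f:S^{m-1}\to S^{n-1}$ be a non-constant eigenmap, that is, a smooth harmonic map (its tension field $\tau(f)=\operatorname{Trace}\nabla \mathrm df$ vanishes identically) whose energy density $e(f)=\tfrac12|\mathrm df|^2$ is constant. Then the map $$F:S^{m-1}\to S^{n},\qquad F(x)=\Bigl(\tfrac{1}{\sqrt2}f(x),\tfrac{1}{\sqrt2}\Bigr),$$ is a proper biharmonic map: it is smooth, it is a critical point of the bienergy $E_2(\varphi)=\tfrac12\int_{S^{m-1}}|\tau(\varphi)|^2\,\mathrm dx$ with respect to all smooth one-parameter variations $(\varphi_t)_{t\in\mathbb R}$, $\varphi_0=F$, through maps $S^{m-1}\to S^n$, and it is not harmonic. -/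

import Mathlib

open scoped Manifold ContDiff

noncomputable section

namespace SphereMap

/-- The Euclidean space `ℝ^(n+1)`. -/
abbrev Ambient (n : ℕ) : Type := EuclideanSpace ℝ (Fin (n + 1))

/-- The unit sphere `S^n ⊆ ℝ^(n+1)`, with the smooth structure that Mathlib puts on it. -/
abbrev Sph (n : ℕ) : Type := Metric.sphere (0 : Ambient n) 1

/-- The tangent space `T_x S^n`: the hyperplane `x^⊥` of `ℝ^(n+1)`. Its inner product is the
restriction of the one of `ℝ^(n+1)` (the round metric). -/
abbrev Tan {n : ℕ} (x : Sph n) : Submodule ℝ (Ambient n) := (ℝ ∙ (x : Ambient n))ᗮ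

/-- The orthogonal projection `ℝ^(n+1) → T_x S^n`. -/
def tanProj {n : ℕ} (x : Sph n) (v : Ambient n) : Ambient n := (Tan x).starProjection v

/-- The extension of `W : S^n → F` to `ℝ^(n+1) \ {0}` that is constant along rays
(with the value `0` at the origin, which plays no role). -/
def radialExt {n : ℕ} {F : Type*} [Zero F] (W : Sph n → F) (y : Ambient n) : F :=
  if h : y = 0 then 0 else W ⟨‖y‖⁻¹ • y, by simp [norm_smul, h]⟩

/-- The directional derivative `D_X W` of a vector valued map `W` on `S^n` at `x`, in the direction
of the tangent vector `X ∈ T_x S^n`, computed with an extension of `W` to a neighbourhood of `x`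
(on tangent vectors the choice of the extension does not matter). -/
def dirDeriv {n : ℕ} {F : Type*} [NormedAddCommGroup F] [NormedSpace ℝ F]
    (W : Sph n → F) (x : Sph n) (X : Ambient n) : F :=
  fderiv ℝ (radialExt W) (x : Ambient n) X

variable {p q : ℕ}

/-- Smooth maps `S^p → S^q`. -/
def IsSmooth (φ : Sph p → Sph q) : Prop := ContMDiff (𝓡 p) (𝓡 q) ∞ φ

/-- The differential `dφ_x(X) ∈ T_{φ(x)} S^q ⊆ ℝ^(q+1)`, for `X ∈ T_x S^p`. -/
def differential (φ : Sph p → Sph q) (x : Sph p) (X : Ambient p) : Ambient q :=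
  dirDeriv (fun y => (φ y : Ambient q)) x X

/-- The pull-back connection `∇^φ_X V` of a vector field `V` along `φ : S^p → S^q`
(`V(y) ∈ T_{φ(y)} S^q`): the tangential part of the Euclidean derivative. -/
def pullbackConn (φ : Sph p → Sph q) (V : Sph p → Ambient q) (x : Sph p) (X : Ambient p) :
    Ambient q :=
  tanProj (φ x) (dirDeriv V x X)

/-- The Levi-Civita connection `∇_X Y` of the round metric of `S^p`: the tangential part of the
Euclidean derivative of the tangent vector field `Y`. -/
def leviCivita (Y : Sph p → Ambient p) (x : Sph p) (X : Ambient p) : Ambient p :=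
  pullbackConn id Y x X

/-- The second fundamental form of `φ`,
`(∇dφ)(X, Y) = ∇^φ_X (dφ(Y)) - dφ(∇_X Y)` at `x`, where the tangent vector `Y ∈ T_x S^p` is extended
to the vector field `y ↦ (tangential part of Y at y)`; the expression is tensorial, so that the
choice of the extension does not matter. -/
def hess (φ : Sph p → Sph q) (x : Sph p) (X Y : Ambient p) : Ambient q :=
  pullbackConn φ (fun y => differential φ y (tanProj y Y)) x X
    - differential φ x (leviCivita (fun y => tanProj y Y) x X)

/-- The tension field `τ(φ) = Trace_g ∇dφ`, as a trace over an orthonormal basis of `T_x S^p`. -/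
def tension (φ : Sph p → Sph q) (x : Sph p) : Ambient q :=
  ∑ i, hess φ x (stdOrthonormalBasis ℝ (Tan x) i) (stdOrthonormalBasis ℝ (Tan x) i)

/-- The energy density `e(φ) = |dφ|^2 / 2`. -/
def energyDensity (φ : Sph p → Sph q) (x : Sph p) : ℝ :=
  (1 / 2) * ∑ i, ‖differential φ x (stdOrthonormalBasis ℝ (Tan x) i)‖ ^ 2

/-- Harmonic maps: smooth maps with vanishing tension field. -/
def IsHarmonic (φ : Sph p → Sph q) : Prop := IsSmooth φ ∧ ∀ x, tension φ x = 0

/-- Eigenmaps: harmonic maps between spheres whose energy density is constant. -/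
def IsEigenmap (φ : Sph p → Sph q) : Prop :=
  IsHarmonic φ ∧ ∃ c : ℝ, ∀ x, energyDensity φ x = c

/-- The bienergy `E₂(φ) = (1/2) ∫_{S^p} |τ(φ)|^2`, for the Riemannian (surface) measure of `S^p`. -/
def bienergy (φ : Sph p → Sph q) : ℝ :=
  (1 / 2) * ∫ x, ‖tension φ x‖ ^ 2
    ∂((MeasureTheory.volume : MeasureTheory.Measure (Ambient p)).toSphere)

/-- Smooth one-parameter variations `(φ_t)` of `φ = φ_0`. -/
def IsVariation (φ : Sph p → Sph q) (Φ : ℝ → Sph p → Sph q) : Prop :=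
  ContMDiff (𝓘(ℝ, ℝ).prod (𝓡 p)) (𝓡 q) ∞ (fun z : ℝ × Sph p => Φ z.1 z.2) ∧ Φ 0 = φ

/-- Biharmonic maps: smooth maps that are critical points of the bienergy. As `S^p` is compact,
it is enough to integrate over all of `S^p` (a variation supported in a compact set `Ω` does not
change the tension field outside `Ω`). -/
def IsBiharmonic (φ : Sph p → Sph q) : Prop :=
  IsSmooth φ ∧ ∀ Φ : ℝ → Sph p → Sph q, IsVariation φ Φ →
    HasDerivAt (fun t => bienergy (Φ t)) 0 0

/-- Proper biharmonic maps: biharmonic maps that are not harmonic. -/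
def IsProperBiharmonic (φ : Sph p → Sph q) : Prop := IsBiharmonic φ ∧ ¬ IsHarmonic φ

/-- The map `F : S^p → S^(q+1)`, `F(x) = (f(x)/√2, 1/√2)`. -/
def lift (f : Sph p → Sph q) (x : Sph p) : Sph (q + 1) :=
  ⟨WithLp.toLp 2 (Fin.snoc (α := fun _ => ℝ)
      (fun i : Fin (q + 1) => (1 / √2) * (f x : Ambient q) i) (1 / √2)), by
    have h : ∑ i, ((f x : Ambient q) i) ^ 2 = 1 := by
      have h1 : ‖(f x : Ambient q)‖ = 1 := by simp
      rw [← EuclideanSpace.real_norm_sq_eq, h1, one_pow]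
    have h2 : ((√2 : ℝ) ^ 2)⁻¹ = 1 / 2 := by norm_num
    rw [mem_sphere_zero_iff_norm, ← sq_eq_sq₀ (norm_nonneg _) zero_le_one,
      EuclideanSpace.real_norm_sq_eq, Fin.sum_univ_castSucc]
    simp only [Fin.snoc_castSucc, Fin.snoc_last, mul_pow, ← Finset.mul_sum, h, one_div, inv_pow, h2]
    norm_num⟩

end SphereMap

end

/-!
Write `u` for the extension of a map `φ : S^p → S^q ⊆ ℝ^(q+1)` to `ℝ^(p+1) \ {0}` that is constant
along rays. Since `Du(y) y = 0`, the auxiliary extensions in the definition of the second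
fundamental form drop out, and the radial second derivative of `u` vanishes. So the tension field
`τ(φ)` is the tangential part of the Euclidean Laplacian `Δu` on the sphere (`tension_eq`), and
`⟨Δu, φ⟩ = -|dφ|²` (`inner_laplacian_ext`) because `|u| = 1`. In particular
`|τ(φ)|² = |Δu|² - ⟨Δu, φ⟩²`, and `φ` is harmonic iff `Δu = -|dφ|² φ`. Below, `Δφ` stands for `Δu`
on the sphere.

Suppose that `|dφ|² = c` is constant, and let `W = Δφ + c φ`. Along a variation `φ_t` with velocity
`V`, the derivative of `|τ(φ_t)|² / 2` at `t = 0` is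
`⟨Δφ, L'⟩ + c (⟨L', φ⟩ + ⟨Δφ, V⟩) = ⟨L', W⟩ + c ⟨Δφ, V⟩`, where `L'` is the derivative of `Δφ_t`.
If `ΔW = -c Δφ`, this is the derivative of `⟨Δφ_t, W⟩ - ⟨φ_t, ΔW⟩`, whose integral is zero for every
`t` by Green's formula. Hence the bienergy is stationary (`isBiharmonic_of_laplacian`); the Laplacian
never has to be exchanged with the derivative in `t`. Green's formula
(`integral_inner_laplacian_sub`) is obtained from the divergence theorem on `ℝ^(p+1)` for the field
`⟨∇A, B⟩ - ⟨A, ∇B⟩`, multiplied by a radial cutoff function, and polar coordinates: the field is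
orthogonal to the radial direction, so that the cutoff function contributes nothing.

For an eigenmap `f` with energy density `e` one has `Δf = -2e f`. The map `F = (f, 1) / √2` satisfies
`ΔF = -√2 e (f, 0)` and `|dF|² = e`, so that `W = (e / √2) (-f, 1)` and `ΔW = √2 e² (f, 0) = -e ΔF`:
`F` is biharmonic. If `F` were harmonic, the last coordinate of `ΔF = -e F` would give `e = 0`, and
`f` would be constant, the sphere being connected.
-/

open scoped RealInnerProductSpace Laplacian Topology
open Set MeasureTheory InnerProductSpace

noncomputable section

namespace SphereMap

/-! ### Radial extensions -/

section RadialExt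

variable {n : ℕ} {F : Type*} [NormedAddCommGroup F] [NormedSpace ℝ F]

lemma radialExt_of_ne {F : Type*} [Zero F] (W : Sph n → F) {y : Ambient n} (h : y ≠ 0) :
    radialExt W y = W ⟨‖y‖⁻¹ • y, by simp [norm_smul, h]⟩ := by
  simp [radialExt, h]

lemma Sph.norm_coe (x : Sph n) : ‖(x : Ambient n)‖ = 1 := by simp

lemma Sph.coe_ne_zero (x : Sph n) : (x : Ambient n) ≠ 0 := by
  intro h
  simpa [h] using x.norm_coe

@[simp]
lemma radialExt_coe {F : Type*} [Zero F] (W : Sph n → F) (x : Sph n) : radialExt W (x : Ambient n) = W x := by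
  rw [radialExt_of_ne W x.coe_ne_zero]
  congr 1
  ext1
  simp

lemma radialExt_smul {F : Type*} [Zero F] (W : Sph n → F) {c : ℝ} (hc : 0 < c) (y : Ambient n) :
    radialExt W (c • y) = radialExt W y := by
  by_cases h : y = 0
  · simp [h]
  · rw [radialExt_of_ne W h, radialExt_of_ne W (smul_ne_zero hc.ne' h)]
    congr 2
    rw [norm_smul, smul_smul, Real.norm_of_nonneg hc.le]
    congr 1
    field_simp

/-- The radial retraction `y ↦ y / |y|` onto the sphere, with the value `x₀` at the origin. -/
def retract (x₀ : Sph n) (y : Ambient n) : Sph n :=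
  if h : y = 0 then x₀ else ⟨‖y‖⁻¹ • y, by simp [norm_smul, h]⟩

lemma contMDiffAt_retract (x₀ : Sph n) {y : Ambient n} (hy : y ≠ 0) :
    ContMDiffAt 𝓘(ℝ, Ambient n) (𝓡 n) ∞ (retract x₀) y := by
  let U : TopologicalSpace.Opens (Ambient n) := ⟨{0}ᶜ, isOpen_compl_singleton⟩
  have hU : ∀ z : U, (z : Ambient n) ≠ 0 := fun z => z.2
  have h1 : ContMDiff 𝓘(ℝ, Ambient n) 𝓘(ℝ, Ambient n) ∞
      (fun z : U => ‖(z : Ambient n)‖⁻¹ • (z : Ambient n)) := by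
    intro z
    have h2 : ContDiffAt ℝ ∞ (fun w : Ambient n => ‖w‖⁻¹ • w) (z : Ambient n) :=
      ((contDiffAt_norm ℝ (hU z)).inv (norm_ne_zero_iff.2 (hU z))).smul contDiffAt_id
    exact (contMDiffAt_subtype_iff (U := U)
      (f := fun w : Ambient n => ‖w‖⁻¹ • w)).2 h2.contMDiffAt
  have := Fact.mk (finrank_euclideanSpace_fin (𝕜 := ℝ) (n := n + 1))
  have h3 := h1.codRestrict_sphere (n := n) (fun z => by simp [norm_smul, hU z])
  have h4 : ContMDiff 𝓘(ℝ, Ambient n) (𝓡 n) ∞ (fun z : U => retract x₀ z) := by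
    convert! h3 using 1
    funext z
    simp [retract, hU z, Set.codRestrict]
  exact (contMDiffAt_subtype_iff (U := U) (f := retract x₀) (x := ⟨y, hy⟩)).1 (h4 _)

/-- The radial extension of a smooth one-parameter family of maps on the sphere is jointly smooth
away from the origin. -/
lemma contDiffAt_radialExt_family {W : ℝ → Sph n → F}
    (hW : ContMDiff (𝓘(ℝ, ℝ).prod (𝓡 n)) 𝓘(ℝ, F) ∞ (fun z : ℝ × Sph n => W z.1 z.2))
    {z : ℝ × Ambient n} (hz : z.2 ≠ 0) :
    ContDiffAt ℝ ∞ (fun z : ℝ × Ambient n => radialExt (W z.1) z.2) z := by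
  have x₀ : Sph n := ⟨‖z.2‖⁻¹ • z.2, by simp [norm_smul, hz]⟩
  have h1 : ContMDiffAt 𝓘(ℝ, ℝ × Ambient n) 𝓘(ℝ, ℝ) ∞ (fun w : ℝ × Ambient n => w.1) z :=
    contDiff_fst.contDiffAt.contMDiffAt
  have h2 : ContMDiffAt 𝓘(ℝ, ℝ × Ambient n) 𝓘(ℝ, Ambient n) ∞ (fun w : ℝ × Ambient n => w.2) z :=
    contDiff_snd.contDiffAt.contMDiffAt
  have h3 := (hW (z.1, retract x₀ z.2)).comp z (h1.prodMk ((contMDiffAt_retract x₀ hz).comp z h2))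
  refine h3.contDiffAt.congr_of_eventuallyEq ?_
  filter_upwards [continuous_snd.continuousAt.eventually_ne hz] with w hw
  simp [radialExt, retract, hw]

lemma contDiffAt_radialExt {W : Sph n → F} (hW : ContMDiff (𝓡 n) 𝓘(ℝ, F) ∞ W)
    {y : Ambient n} (hy : y ≠ 0) : ContDiffAt ℝ ∞ (radialExt W) y :=
  (contDiffAt_radialExt_family (W := fun _ => W) (hW.comp contMDiff_snd) (z := (0, y)) hy).comp y
    (contDiffAt_const.prodMk contDiffAt_id)

end RadialExt

/-! ### Calculus of maps that are constant along rays -/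

section Homogeneous

variable {E F : Type*} [NormedAddCommGroup E] [InnerProductSpace ℝ E]
  [NormedAddCommGroup F] [InnerProductSpace ℝ F] {u : E → F}

lemma fderiv_smul_of_const_rays (hu : ∀ c : ℝ, 0 < c → ∀ y, u (c • y) = u y) {c : ℝ} (hc : 0 < c)
    (y : E) : fderiv ℝ u (c • y) = c⁻¹ • fderiv ℝ u y := by
  have h : fderiv ℝ (u <| c • ·) y = c • fderiv ℝ u (c • y) := fderiv_comp_smul c
  rw [funext (hu c hc)] at h
  rw [h, smul_smul, inv_mul_cancel₀ hc.ne', one_smul]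

lemma fderiv_fderiv_smul_of_const_rays (hu : ∀ c : ℝ, 0 < c → ∀ y, u (c • y) = u y) {c : ℝ}
    (hc : 0 < c) (y : E) :
    fderiv ℝ (fderiv ℝ u) (c • y) = (c ^ 2)⁻¹ • fderiv ℝ (fderiv ℝ u) y := by
  have h : fderiv ℝ (fun z => fderiv ℝ u (c • z)) y = c • fderiv ℝ (fderiv ℝ u) (c • y) :=
    fderiv_comp_smul c
  rw [funext (fderiv_smul_of_const_rays hu hc)] at h
  have h2 : fderiv ℝ (fun z => c⁻¹ • fderiv ℝ u z) y = c⁻¹ • fderiv ℝ (fderiv ℝ u) y :=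
    congrFun (fderiv_const_smul_field (𝕜 := ℝ) (f := fderiv ℝ u) c⁻¹) y
  rw [h2] at h
  have h3 := congrArg (fun A => c⁻¹ • A) h
  simp only [smul_smul, inv_mul_cancel₀ hc.ne', one_smul] at h3
  rw [← h3]
  congr 1
  field_simp

lemma fderiv_apply_self_of_const_rays (hu : ∀ c : ℝ, 0 < c → ∀ y, u (c • y) = u y) {y : E}
    (hd : DifferentiableAt ℝ u y) : fderiv ℝ u y y = 0 := by
  have h1 : HasDerivAt (fun c : ℝ => c • y) y 1 := by
    simpa using (hasDerivAt_id (1 : ℝ)).smul_const y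
  have h2 : HasDerivAt (fun c : ℝ => u (c • y)) (fderiv ℝ u y y) 1 :=
    HasFDerivAt.comp_hasDerivAt (l := u) (1 : ℝ) (by simpa using hd.hasFDerivAt) h1
  have h3 : (fun c : ℝ => u (c • y)) =ᶠ[𝓝 1] fun _ => u y := by
    filter_upwards [lt_mem_nhds (zero_lt_one' ℝ)] with c hc using hu c hc y
  exact h2.unique ((hasDerivAt_const _ _).congr_of_eventuallyEq h3)

lemma fderiv_fderiv_apply_self_of_const_rays (hu : ∀ c : ℝ, 0 < c → ∀ y, u (c • y) = u y) {y : E}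
    (hy : y ≠ 0) (hd : ∀ z : E, z ≠ 0 → ContDiffAt ℝ ∞ u z) :
    fderiv ℝ (fderiv ℝ u) y y y = 0 := by
  have h0 : (fun z => fderiv ℝ u z z) =ᶠ[𝓝 y] fun _ => (0 : F) := by
    filter_upwards [isOpen_ne.mem_nhds hy] with z hz
    exact fderiv_apply_self_of_const_rays hu ((hd z hz).differentiableAt (by simp))
  have h1 : DifferentiableAt ℝ (fderiv ℝ u) y :=
    ((hd y hy).fderiv_right (m := 1) (by norm_cast)).differentiableAt (by simp)
  have h2 := h1.hasFDerivAt.clm_apply (hasFDerivAt_id y)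
  have h3 := congrArg (fun A : E →L[ℝ] F => A y)
    (h2.unique ((hasFDerivAt_const (0 : F) y).congr_of_eventuallyEq h0))
  simpa [fderiv_apply_self_of_const_rays hu ((hd y hy).differentiableAt (by simp))] using h3

variable [FiniteDimensional ℝ E]

lemma laplacian_eq_sum_fderiv {ι : Type*} [Fintype ι] (b : OrthonormalBasis ι ℝ E) (u : E → F)
    (x : E) : Δ u x = ∑ i, fderiv ℝ (fderiv ℝ u) x (b i) (b i) := by
  simp [laplacian_eq_iteratedFDeriv_orthonormalBasis u b, iteratedFDeriv_two_apply]

lemma laplacian_smul_of_const_rays (hu : ∀ c : ℝ, 0 < c → ∀ y, u (c • y) = u y) {c : ℝ}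
    (hc : 0 < c) (y : E) : Δ u (c • y) = (c ^ 2)⁻¹ • Δ u y := by
  simp [laplacian_eq_sum_fderiv (stdOrthonormalBasis ℝ E),
    fderiv_fderiv_smul_of_const_rays hu hc, Finset.smul_sum]

end Homogeneous

/-! ### The tension field and the energy density in Euclidean terms -/

section Tension

variable {n p q : ℕ}

/-- The extension of `φ : S^p → S^q ⊆ ℝ^(q+1)` to `ℝ^(p+1)` that is constant along rays, as a
vector valued map. -/
def ext (φ : Sph p → Sph q) : Ambient p → Ambient q := radialExt fun y => (φ y : Ambient q)

@[simp]
lemma ext_coe (φ : Sph p → Sph q) (x : Sph p) : ext φ (x : Ambient p) = φ x := radialExt_coe _ x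

lemma ext_smul (φ : Sph p → Sph q) (c : ℝ) (hc : 0 < c) (y : Ambient p) :
    ext φ (c • y) = ext φ y := radialExt_smul _ hc y

lemma norm_ext (φ : Sph p → Sph q) {y : Ambient p} (hy : y ≠ 0) : ‖ext φ y‖ = 1 := by
  rw [ext, radialExt_of_ne _ hy]
  exact Sph.norm_coe _

lemma contMDiff_coe_Sph : ContMDiff (𝓡 n) 𝓘(ℝ, Ambient n) ∞ ((↑) : Sph n → Ambient n) := by
  have := Fact.mk (finrank_euclideanSpace_fin (𝕜 := ℝ) (n := n + 1))
  exact contMDiff_coe_sphere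

lemma IsSmooth.contDiffAt_ext {φ : Sph p → Sph q} (hφ : IsSmooth φ) {y : Ambient p} (hy : y ≠ 0) :
    ContDiffAt ℝ ∞ (ext φ) y :=
  contDiffAt_radialExt (contMDiff_coe_Sph.comp hφ) hy

lemma tanProj_apply (x : Sph n) (v : Ambient n) :
    tanProj x v = v - ⟪(x : Ambient n), v⟫ • (x : Ambient n) := by
  rw [tanProj, Submodule.starProjection_orthogonal_val,
    Submodule.starProjection_unit_singleton ℝ x.norm_coe]

lemma inner_coe_self (x : Sph n) : ⟪(x : Ambient n), (x : Ambient n)⟫ = 1 := by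
  rw [real_inner_self_eq_norm_sq, x.norm_coe, one_pow]

lemma norm_tanProj_sq (x : Sph n) (v : Ambient n) :
    ‖tanProj x v‖ ^ 2 = ‖v‖ ^ 2 - ⟪v, (x : Ambient n)⟫ ^ 2 := by
  rw [tanProj_apply, norm_sub_sq_real, norm_smul, x.norm_coe, inner_smul_right,
    real_inner_comm v, Real.norm_eq_abs, mul_one, sq_abs]
  ring

/-- The auxiliary vector field along `φ` in the definition of `hess` extends, up to the factor
`|y|`, to the Euclidean derivative of the extension of `φ`. -/
lemma radialExt_differential {φ : Sph p → Sph q} (hφ : IsSmooth φ) (Y : Ambient p) {y : Ambient p}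
    (hy : y ≠ 0) :
    radialExt (fun z => differential φ z (tanProj z Y)) y = ‖y‖ • fderiv ℝ (ext φ) y Y := by
  have hn : 0 < ‖y‖⁻¹ := inv_pos.2 (norm_pos_iff.2 hy)
  rw [radialExt_of_ne _ hy, differential, dirDeriv, tanProj_apply, map_sub, map_smul]
  change fderiv ℝ (ext φ) (‖y‖⁻¹ • y) Y - _ • fderiv ℝ (ext φ) (‖y‖⁻¹ • y) (‖y‖⁻¹ • y) = _
  rw [fderiv_apply_self_of_const_rays (ext_smul φ)
    ((hφ.contDiffAt_ext (smul_ne_zero hn.ne' hy)).differentiableAt (by simp)), smul_zero, sub_zero,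
    fderiv_smul_of_const_rays (ext_smul φ) hn]
  simp

lemma hasFDerivAt_norm_of_ne_zero {y : Ambient n} (hy : y ≠ 0) :
    HasFDerivAt (fun z : Ambient n => ‖z‖) (‖y‖⁻¹ • innerSL ℝ y) y := by
  have h := (hasStrictFDerivAt_norm_sq y).hasFDerivAt.sqrt (pow_ne_zero 2 (norm_ne_zero_iff.2 hy))
  simp only [Real.sqrt_sq (norm_nonneg _)] at h
  refine h.congr_fderiv ?_
  ext v
  simp
  field_simp

lemma hess_eq {φ : Sph p → Sph q} (hφ : IsSmooth φ) {x : Sph p} {X Y : Ambient p}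
    (hX : X ∈ Tan x) (hY : Y ∈ Tan x) :
    hess φ x X Y = tanProj (φ x) (fderiv ℝ (fderiv ℝ (ext φ)) x X Y) := by
  have hx := x.coe_ne_zero
  have hX' := Submodule.mem_orthogonal_singleton_iff_inner_right.1 hX
  have hY' := Submodule.mem_orthogonal_singleton_iff_inner_right.1 hY
  have h1 : dirDeriv (fun z => differential φ z (tanProj z Y)) x X =
      fderiv ℝ (fderiv ℝ (ext φ)) x X Y := by
    have hd : DifferentiableAt ℝ (fderiv ℝ (ext φ)) (x : Ambient p) :=
      ((hφ.contDiffAt_ext hx).fderiv_right (m := 1) (by norm_cast)).differentiableAt (by simp)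
    have h2 := (hasFDerivAt_norm_of_ne_zero hx).smul
      (hd.hasFDerivAt.clm_apply (hasFDerivAt_const Y (x : Ambient p)))
    have h3 : radialExt (fun z => differential φ z (tanProj z Y)) =ᶠ[𝓝 (x : Ambient p)]
        ((fun z : Ambient p => ‖z‖) • fun z => fderiv ℝ (ext φ) z Y) := by
      filter_upwards [isOpen_ne.mem_nhds hx] with z hz
      exact radialExt_differential hφ Y hz
    rw [dirDeriv, (h2.congr_of_eventuallyEq h3).fderiv]
    simp [hX', x.norm_coe]
  have h2 : leviCivita (fun y => tanProj y Y) x X = 0 := by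
    -- The extension is `Y - g(y) y` with `g(x) = 0`, so its derivative at `x` is a multiple of `x`.
    have hg : DifferentiableAt ℝ (fun z : Ambient p => (‖z‖ ^ 2)⁻¹ * ⟪z, Y⟫) x := by
      refine DifferentiableAt.mul (DifferentiableAt.inv ?_ (by simp)) ?_
      · exact (hasStrictFDerivAt_norm_sq _).hasFDerivAt.differentiableAt
      · exact differentiableAt_id.inner ℝ (differentiableAt_const _)
    have h3 := (hasFDerivAt_const Y (x : Ambient p)).sub (hg.hasFDerivAt.smul (hasFDerivAt_id _))
    have h4 : radialExt (fun z => tanProj z Y) =ᶠ[𝓝 (x : Ambient p)]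
        ((fun _ => Y) - (fun z : Ambient p => (‖z‖ ^ 2)⁻¹ * ⟪z, Y⟫) • id) := by
      filter_upwards [isOpen_ne.mem_nhds hx] with z hz
      rw [radialExt_of_ne _ hz, tanProj_apply]
      simp only [Pi.sub_apply, Pi.smul_apply', id, inner_smul_left, smul_smul, conj_trivial]
      congr 2
      field_simp
    rw [leviCivita, pullbackConn, dirDeriv, (h3.congr_of_eventuallyEq h4).fderiv, tanProj_apply]
    simp [hY', inner_smul_right]
  rw [hess, h2, pullbackConn, h1]
  simp [differential, dirDeriv]

/-- An orthonormal basis of `T_x S^p`, completed by `x`, is an orthonormal basis of `ℝ^(p+1)`. -/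
lemma exists_orthonormalBasis_option {ι : Type*} [Fintype ι] (x : Sph p)
    (e : OrthonormalBasis ι ℝ (Tan x)) :
    ∃ b : OrthonormalBasis (Option ι) ℝ (Ambient p), b none = x ∧ ∀ i, b (some i) = e i := by
  classical
  have := Fact.mk (finrank_euclideanSpace_fin (𝕜 := ℝ) (n := p + 1))
  have hc : Module.finrank ℝ (Ambient p) = Fintype.card (Option ι) := by
    rw [Fintype.card_option, ← Module.finrank_eq_card_basis e.toBasis,
      Submodule.finrank_orthogonal_span_singleton (n := p) x.coe_ne_zero, finrank_euclideanSpace_fin]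
  let v : Option ι → Ambient p := fun o => o.elim (x : Ambient p) fun i => (e i : Ambient p)
  have hxe : ∀ i, ⟪(x : Ambient p), (e i : Ambient p)⟫ = 0 := fun i =>
    Submodule.mem_orthogonal_singleton_iff_inner_right.1 (e i).2
  have hv : Orthonormal ℝ v := by
    rw [orthonormal_iff_ite]
    rintro (_ | i) (_ | j)
    · simp [v]
    · simpa [v] using hxe j
    · simpa [v, real_inner_comm] using hxe i
    · simpa [v] using orthonormal_iff_ite.1 e.orthonormal i j
  obtain ⟨b, hb⟩ := Orthonormal.exists_orthonormalBasis_extension_of_card_eq hc (v := v)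
    (s := univ) (hv.comp _ Subtype.val_injective)
  exact ⟨b, hb none trivial, fun i => hb (some i) trivial⟩

/-- The tension field is the tangential part of the Euclidean Laplacian of the extension:
the trace over `T_x S^p` equals the full trace, the radial second derivative being zero. -/
lemma tension_eq {φ : Sph p → Sph q} (hφ : IsSmooth φ) (x : Sph p) :
    tension φ x = tanProj (φ x) (Δ (ext φ) x) := by
  obtain ⟨b, hb, hb'⟩ := exists_orthonormalBasis_option x (stdOrthonormalBasis ℝ (Tan x))
  rw [laplacian_eq_sum_fderiv b, Fintype.sum_option, hb,
    fderiv_fderiv_apply_self_of_const_rays (ext_smul φ) x.coe_ne_zero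
      fun z hz => hφ.contDiffAt_ext hz, zero_add, tension, tanProj, map_sum]
  refine Finset.sum_congr rfl fun i _ => ?_
  rw [hess_eq hφ (Submodule.coe_mem _) (Submodule.coe_mem _), hb', tanProj]

lemma norm_tension_sq {φ : Sph p → Sph q} (hφ : IsSmooth φ) (x : Sph p) :
    ‖tension φ x‖ ^ 2 = ‖Δ (ext φ) x‖ ^ 2 - ⟪Δ (ext φ) x, (φ x : Ambient q)⟫ ^ 2 := by
  rw [tension_eq hφ, norm_tanProj_sq]

/-- `⟨u_XX, u⟩ = -|u_X|²` for a map `u` into the unit sphere. -/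
lemma inner_fderiv_fderiv_ext {φ : Sph p → Sph q} (hφ : IsSmooth φ) {y : Ambient p} (hy : y ≠ 0)
    (X : Ambient p) :
    ⟪fderiv ℝ (fderiv ℝ (ext φ)) y X X, ext φ y⟫ = -‖fderiv ℝ (ext φ) y X‖ ^ 2 := by
  have hd : ∀ z : Ambient p, z ≠ 0 → DifferentiableAt ℝ (ext φ) z := fun z hz =>
    (hφ.contDiffAt_ext hz).differentiableAt (by simp)
  have hd' : DifferentiableAt ℝ (fderiv ℝ (ext φ)) y :=
    ((hφ.contDiffAt_ext hy).fderiv_right (m := 1) (by norm_cast)).differentiableAt (by simp)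
  have h1 : ∀ z : Ambient p, z ≠ 0 → ⟪fderiv ℝ (ext φ) z X, ext φ z⟫ = 0 := by
    intro z hz
    have h2 := (hd z hz).hasFDerivAt.norm_sq
    have h3 : (fun w => ‖ext φ w‖ ^ 2) =ᶠ[𝓝 z] fun _ => (1 : ℝ) := by
      filter_upwards [isOpen_ne.mem_nhds hz] with w hw
      rw [norm_ext φ hw, one_pow]
    have h4 := congrArg (fun A : Ambient p →L[ℝ] ℝ => A X)
      (h2.unique ((hasFDerivAt_const (1 : ℝ) z).congr_of_eventuallyEq h3))
    simpa [real_inner_comm] using h4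
  have h2 : (fun z => ⟪fderiv ℝ (ext φ) z X, ext φ z⟫) =ᶠ[𝓝 y] fun _ => (0 : ℝ) := by
    filter_upwards [isOpen_ne.mem_nhds hy] with z hz using h1 z hz
  have h3 := (hd'.hasFDerivAt.clm_apply (hasFDerivAt_const X y)).inner ℝ (hd y hy).hasFDerivAt
  have h4 := congrArg (fun A : Ambient p →L[ℝ] ℝ => A X)
      (h3.unique ((hasFDerivAt_const (0 : ℝ) y).congr_of_eventuallyEq h2))
  simp at h4
  linarith

lemma inner_laplacian_ext {φ : Sph p → Sph q} (hφ : IsSmooth φ) (x : Sph p) :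
    ⟪Δ (ext φ) x, (φ x : Ambient q)⟫ = -(2 * energyDensity φ x) := by
  obtain ⟨b, hb, hb'⟩ := exists_orthonormalBasis_option x (stdOrthonormalBasis ℝ (Tan x))
  rw [laplacian_eq_sum_fderiv b, Fintype.sum_option, hb,
    fderiv_fderiv_apply_self_of_const_rays (ext_smul φ) x.coe_ne_zero
      fun z hz => hφ.contDiffAt_ext hz, zero_add, sum_inner, energyDensity, ← ext_coe φ x]
  simp only [inner_fderiv_fderiv_ext hφ x.coe_ne_zero, Finset.sum_neg_distrib, hb']
  rw [← mul_assoc]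
  norm_num
  rfl

end Tension

/-! ### Green's formula on the sphere -/

section Green

variable {n : ℕ}

/-- A smooth bump function on `ℝ` that is supported in `[1/2, 3/2]`. -/
def bump : ContDiffBump (1 : ℝ) := ⟨1 / 4, 1 / 2, by norm_num, by norm_num⟩

/-- A smooth radial function on `ℝ^(n+1)` that is supported in an annulus. -/
def cutoff (y : Ambient n) : ℝ := bump (‖y‖ ^ 2)

lemma contDiff_cutoff : ContDiff ℝ ∞ (cutoff (n := n)) :=
  bump.contDiff.comp (contDiff_norm_sq ℝ)

lemma cutoff_eq_zero {y : Ambient n} (hy : ‖y‖ ^ 2 ≤ 1 / 2 ∨ 3 / 2 ≤ ‖y‖ ^ 2) : cutoff y = 0 := by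
  refine bump.zero_of_le_dist ?_
  simp only [bump, Real.dist_eq]
  rcases hy with hy | hy
  · rw [abs_of_nonpos (by linarith)]
    linarith
  · rw [abs_of_nonneg (by linarith)]
    linarith

lemma cutoff_eventuallyEq_zero : cutoff (n := n) =ᶠ[𝓝 0] fun _ => 0 := by
  filter_upwards [Metric.ball_mem_nhds (0 : Ambient n) (ε := 1 / 2) (by norm_num)] with y hy
  rw [mem_ball_zero_iff] at hy
  exact cutoff_eq_zero (Or.inl (by nlinarith [norm_nonneg y]))

lemma hasCompactSupport_cutoff : HasCompactSupport (cutoff (n := n)) := by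
  refine HasCompactSupport.intro (isCompact_closedBall (0 : Ambient n) 2) fun y hy => ?_
  rw [mem_closedBall_zero_iff, not_le] at hy
  exact cutoff_eq_zero (Or.inr (by nlinarith))

lemma fderiv_cutoff (y v : Ambient n) :
    fderiv ℝ cutoff y v = 2 * deriv bump (‖y‖ ^ 2) * ⟪y, v⟫ := by
  have h1 : HasDerivAt bump (deriv bump (‖y‖ ^ 2)) (‖y‖ ^ 2) :=
    ((bump.contDiff (n := 1)).differentiable (by simp) _).hasDerivAt
  have h2 : HasFDerivAt cutoff _ y := h1.comp_hasFDerivAt y (hasStrictFDerivAt_norm_sq y).hasFDerivAt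
  rw [h2.fderiv]
  simp
  ring

/-- Integration in polar coordinates of a function that is homogeneous of degree `-2`, against the
cutoff function. -/
lemma integral_cutoff_mul {k : Ambient n → ℝ}
    (hk : ∀ c : ℝ, 0 < c → ∀ y, k (c • y) = (c ^ 2)⁻¹ * k y) :
    ∫ y, cutoff y * k y =
      (∫ x : Sph n, k x ∂(volume : Measure (Ambient n)).toSphere) *
        ∫ r : Ioi (0 : ℝ), bump (r.1 ^ 2) * (r.1 ^ 2)⁻¹
          ∂(Measure.volumeIoiPow (Module.finrank ℝ (Ambient n) - 1)) := by
  have hp := (volume : Measure (Ambient n)).measurePreserving_homeomorphUnitSphereProd.integral_comp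
    (Homeomorph.measurableEmbedding _)
    (fun z : Sph n × Ioi (0 : ℝ) => k z.1 * (bump (z.2.1 ^ 2) * (z.2.1 ^ 2)⁻¹))
  rw [← integral_prod_mul (fun x : Sph n => k x)
    (fun r : Ioi (0 : ℝ) => bump (r.1 ^ 2) * (r.1 ^ 2)⁻¹), ← hp]
  have hs := integral_subtype_comap (μ := volume) (measurableSet_singleton (0 : Ambient n)).compl
    fun y : Ambient n => cutoff y * k y
  rw [restrict_compl_singleton] at hs
  rw [← hs]
  congr 1 with y
  have hy : 0 < ‖(y : Ambient n)‖ := norm_pos_iff.2 y.2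
  have h := hk ‖(y : Ambient n)‖⁻¹ (inv_pos.2 hy) y
  simp only [homeomorphUnitSphereProd_apply_fst_coe, homeomorphUnitSphereProd_apply_snd_coe, h,
    cutoff]
  field_simp

lemma integral_toSphere_eq_zero {k : Ambient n → ℝ}
    (hk : ∀ c : ℝ, 0 < c → ∀ y, k (c • y) = (c ^ 2)⁻¹ * k y)
    (h0 : ∫ y, cutoff y * k y = 0) :
    ∫ x : Sph n, k x ∂(volume : Measure (Ambient n)).toSphere = 0 := by
  rw [integral_cutoff_mul hk] at h0
  refine (mul_eq_zero.1 h0).resolve_right fun hC => ?_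
  -- The radial factor is not zero, as one sees by applying the formula to `|y|⁻²`.
  have h1 := integral_cutoff_mul (n := n) (k := fun y => (‖y‖ ^ 2)⁻¹) fun c hc y => by
    rw [norm_smul, mul_pow, mul_inv, Real.norm_of_nonneg hc.le]
  rw [hC, mul_zero] at h1
  have hcont : Continuous fun y : Ambient n => cutoff y * (‖y‖ ^ 2)⁻¹ := by
    rw [continuous_iff_continuousAt]
    intro y
    by_cases hy : y = 0
    · subst hy
      refine (continuousAt_const (y := (0 : ℝ))).congr ?_
      filter_upwards [cutoff_eventuallyEq_zero (n := n)] with z hz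
      rw [hz, zero_mul]
    · exact contDiff_cutoff.continuous.continuousAt.mul
        ((continuous_norm.pow 2).continuousAt.inv₀ (pow_ne_zero 2 (norm_ne_zero_iff.2 hy)))
  refine (hcont.integral_pos_of_hasCompactSupport_nonneg_nonzero (μ := volume)
    hasCompactSupport_cutoff.mul_right
    (fun y => mul_nonneg bump.nonneg (by positivity)) (x := EuclideanSpace.single 0 1) ?_).ne' h1
  simp [cutoff, bump.one_of_mem_closedBall (Metric.mem_closedBall_self bump.rIn_pos.le)]

lemma integral_fderiv_eq_zero {g : Ambient n → ℝ} (hg : ContDiff ℝ 1 g) (hc : HasCompactSupport g)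
    (v : Ambient n) : ∫ y, fderiv ℝ g y v = 0 := by
  have hd : Continuous fun y => fderiv ℝ g y v :=
    (hg.continuous_fderiv (by simp)).clm_apply continuous_const
  have hi : Integrable fun y => fderiv ℝ g y v :=
    hd.integrable_of_hasCompactSupport (hc.fderiv_apply (𝕜 := ℝ) v)
  have h := integral_mul_fderiv_eq_neg_fderiv_mul_of_integrable (μ := volume) (𝕜 := ℝ)
    (f := fun _ : Ambient n => (1 : ℝ)) (g := g) (v := v) (by simp) (by simpa using hi)
    (by simpa using hg.continuous.integrable_of_hasCompactSupport hc)
    (fun _ _ => differentiableAt_const _) (fun y _ => hg.differentiable (by simp) y)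
  simpa using h

variable {F : Type*} [NormedAddCommGroup F] [InnerProductSpace ℝ F] {A B : Ambient n → F}

/-- The component in the direction `v` of the vector field `⟨∇A, B⟩ - ⟨A, ∇B⟩`. -/
def greenField (A B : Ambient n → F) (v y : Ambient n) : ℝ :=
  ⟪fderiv ℝ A y v, B y⟫ - ⟪A y, fderiv ℝ B y v⟫

lemma contDiffAt_greenField (hA : ∀ y, y ≠ 0 → ContDiffAt ℝ ∞ A y)
    (hB : ∀ y, y ≠ 0 → ContDiffAt ℝ ∞ B y) (v : Ambient n) {y : Ambient n} (hy : y ≠ 0) :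
    ContDiffAt ℝ 1 (greenField A B v) y := by
  have hA' : ContDiffAt ℝ 1 (fderiv ℝ A) y := (hA y hy).fderiv_right (by norm_cast)
  have hB' : ContDiffAt ℝ 1 (fderiv ℝ B) y := (hB y hy).fderiv_right (by norm_cast)
  exact ((hA'.clm_apply contDiffAt_const).inner ℝ ((hB y hy).of_le (by norm_cast))).sub
    (((hA y hy).of_le (by norm_cast)).inner ℝ (hB'.clm_apply contDiffAt_const))

lemma fderiv_greenField (hA : ∀ y, y ≠ 0 → ContDiffAt ℝ ∞ A y)
    (hB : ∀ y, y ≠ 0 → ContDiffAt ℝ ∞ B y) (v : Ambient n) {y : Ambient n} (hy : y ≠ 0) :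
    fderiv ℝ (greenField A B v) y v =
      ⟪fderiv ℝ (fderiv ℝ A) y v v, B y⟫ - ⟪A y, fderiv ℝ (fderiv ℝ B) y v v⟫ := by
  have dA := ((hA y hy).differentiableAt (by simp)).hasFDerivAt
  have dB := ((hB y hy).differentiableAt (by simp)).hasFDerivAt
  have dA' := (((hA y hy).fderiv_right (m := 1) (by norm_cast)).differentiableAt
    (by simp)).hasFDerivAt.clm_apply (hasFDerivAt_const v y)
  have dB' := (((hB y hy).fderiv_right (m := 1) (by norm_cast)).differentiableAt
    (by simp)).hasFDerivAt.clm_apply (hasFDerivAt_const v y)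
  have h : HasFDerivAt (greenField A B v) _ y := (dA'.inner ℝ dB).sub (dA.inner ℝ dB')
  rw [h.fderiv]
  simp
  ring

lemma contDiff_cutoff_mul_greenField (hA : ∀ y, y ≠ 0 → ContDiffAt ℝ ∞ A y)
    (hB : ∀ y, y ≠ 0 → ContDiffAt ℝ ∞ B y) (v : Ambient n) :
    ContDiff ℝ 1 fun y => cutoff y * greenField A B v y := by
  rw [contDiff_iff_contDiffAt]
  intro y
  by_cases hy : y = 0
  · subst hy
    refine (contDiffAt_const (c := (0 : ℝ))).congr_of_eventuallyEq ?_
    filter_upwards [cutoff_eventuallyEq_zero (n := n)] with z hz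
    rw [hz, zero_mul]
  · exact (contDiff_cutoff.of_le (by norm_cast)).contDiffAt.mul (contDiffAt_greenField hA hB v hy)

/-- The divergence of the cut off field: as the field is tangential to the spheres around the
origin, the radial cutoff function does not contribute. -/
lemma sum_fderiv_cutoff_mul_greenField (hA : ∀ y, y ≠ 0 → ContDiffAt ℝ ∞ A y)
    (hB : ∀ y, y ≠ 0 → ContDiffAt ℝ ∞ B y) (hA0 : ∀ c : ℝ, 0 < c → ∀ y, A (c • y) = A y)
    (hB0 : ∀ c : ℝ, 0 < c → ∀ y, B (c • y) = B y) {ι : Type*} [Fintype ι]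
    (b : OrthonormalBasis ι ℝ (Ambient n)) (y : Ambient n) :
    ∑ i, fderiv ℝ (fun z => cutoff z * greenField A B (b i) z) y (b i) =
      cutoff y * (⟪Δ A y, B y⟫ - ⟪A y, Δ B y⟫) := by
  by_cases hy : y = 0
  · subst hy
    have h : ∀ i, (fun z => cutoff z * greenField A B (b i) z) =ᶠ[𝓝 0] fun _ => 0 := by
      intro i
      filter_upwards [cutoff_eventuallyEq_zero (n := n)] with z hz
      rw [hz, zero_mul]
    simp [(h _).fderiv_eq, cutoff_eventuallyEq_zero.eq_of_nhds]
  have h1 : ∀ i, fderiv ℝ (fun z => cutoff z * greenField A B (b i) z) y (b i) =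
      cutoff y * (⟪fderiv ℝ (fderiv ℝ A) y (b i) (b i), B y⟫ -
        ⟪A y, fderiv ℝ (fderiv ℝ B) y (b i) (b i)⟫) +
      2 * deriv bump (‖y‖ ^ 2) * (⟪fderiv ℝ A y (⟪b i, y⟫ • b i), B y⟫ -
        ⟪A y, fderiv ℝ B y (⟪b i, y⟫ • b i)⟫) := by
    intro i
    have h := ((contDiff_cutoff (n := n)).differentiable (by simp) y).hasFDerivAt.mul
      ((contDiffAt_greenField hA hB (b i) hy).differentiableAt (by simp)).hasFDerivAt
    change fderiv ℝ (cutoff * greenField A B (b i)) y (b i) = _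
    rw [h.fderiv]
    simp only [add_apply, smul_apply, smul_eq_mul,
      fderiv_cutoff, fderiv_greenField hA hB _ hy, map_smul, inner_smul_left, inner_smul_right,
      greenField, conj_trivial, real_inner_comm (b i) y]
    ring
  have hA1 := fderiv_apply_self_of_const_rays hA0 ((hA y hy).differentiableAt (by simp))
  have hB1 := fderiv_apply_self_of_const_rays hB0 ((hB y hy).differentiableAt (by simp))
  rw [Finset.sum_congr rfl fun i _ => h1 i, Finset.sum_add_distrib, ← Finset.mul_sum,
    ← Finset.mul_sum, Finset.sum_sub_distrib, Finset.sum_sub_distrib, ← sum_inner, ← sum_inner,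
    ← inner_sum, ← inner_sum, ← map_sum, ← map_sum, b.sum_repr' y, hA1, hB1,
    laplacian_eq_sum_fderiv b, laplacian_eq_sum_fderiv b]
  simp

/-- Green's formula on the sphere: the Laplacian is symmetric. -/
theorem integral_inner_laplacian_sub (hA : ∀ y, y ≠ 0 → ContDiffAt ℝ ∞ A y)
    (hB : ∀ y, y ≠ 0 → ContDiffAt ℝ ∞ B y) (hA0 : ∀ c : ℝ, 0 < c → ∀ y, A (c • y) = A y)
    (hB0 : ∀ c : ℝ, 0 < c → ∀ y, B (c • y) = B y) :
    ∫ x : Sph n, (⟪Δ A x, B x⟫ - ⟪A x, Δ B x⟫) ∂(volume : Measure (Ambient n)).toSphere = 0 := by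
  refine integral_toSphere_eq_zero (k := fun y => ⟪Δ A y, B y⟫ - ⟪A y, Δ B y⟫) (fun c hc y => ?_) ?_
  · rw [laplacian_smul_of_const_rays hA0 hc, laplacian_smul_of_const_rays hB0 hc, hA0 c hc, hB0 c hc,
      inner_smul_left, inner_smul_right, conj_trivial]
    ring
  · let b := stdOrthonormalBasis ℝ (Ambient n)
    have hg := contDiff_cutoff_mul_greenField hA hB
    have hs : ∀ v, HasCompactSupport fun y => cutoff y * greenField A B v y := fun v =>
      hasCompactSupport_cutoff.mul_right
    simp_rw [← sum_fderiv_cutoff_mul_greenField hA hB hA0 hB0 b]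
    rw [integral_finsetSum]
    · exact Finset.sum_eq_zero fun i _ => integral_fderiv_eq_zero (hg _) (hs _) _
    · intro i _
      exact (((hg (b i)).continuous_fderiv (by simp)).clm_apply
        continuous_const).integrable_of_hasCompactSupport ((hs _).fderiv_apply (𝕜 := ℝ) _)

end Green

/-! ### Differentiation under the integral -/

section Parametric

variable {n : ℕ} {F : Type*} [NormedAddCommGroup F] [InnerProductSpace ℝ F]

lemma integrable_toSphere {g : Ambient n → ℝ} (hg : ∀ y, y ≠ 0 → ContinuousAt g y) :
    Integrable (fun x : Sph n => g x) (volume : Measure (Ambient n)).toSphere := by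
  have h : Continuous fun x : Sph n => g x := continuous_iff_continuousAt.2 fun x =>
    ContinuousAt.comp (f := ((↑) : Sph n → Ambient n)) (hg x x.coe_ne_zero)
      continuous_subtype_val.continuousAt
  exact h.integrable_of_hasCompactSupport (HasCompactSupport.of_compactSpace _)

/-- If the integrand is `C¹` and stationary in the parameter at every point of the sphere, then the
integral is stationary. -/
lemma hasDerivAt_integral_toSphere_zero {R : ℝ × Ambient n → ℝ}
    (hR : ∀ z : ℝ × Ambient n, z.2 ≠ 0 → ContDiffAt ℝ 1 R z)
    (h0 : ∀ x : Sph n, HasDerivAt (fun t => R (t, (x : Ambient n))) 0 0) :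
    HasDerivAt (fun t => ∫ x : Sph n, R (t, (x : Ambient n))
      ∂(volume : Measure (Ambient n)).toSphere) 0 0 := by
  have hd : ∀ (t : ℝ) (x : Sph n), HasDerivAt (fun t => R (t, (x : Ambient n)))
      (fderiv ℝ R (t, (x : Ambient n)) (1, 0)) t := fun t x =>
    ((hR (t, x) x.coe_ne_zero).differentiableAt (by simp)).hasFDerivAt.comp_hasDerivAt t
      ((hasDerivAt_id t).prodMk (hasDerivAt_const t (x : Ambient n)))
  have hcont : Continuous fun z : ℝ × Sph n => fderiv ℝ R (z.1, (z.2 : Ambient n)) (1, 0) := by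
    refine continuous_iff_continuousAt.2 fun z => ?_
    have h1 : ContinuousAt (fderiv ℝ R) (z.1, (z.2 : Ambient n)) :=
      ((hR (z.1, z.2) z.2.coe_ne_zero).fderiv_right (m := 0) (by simp)).continuousAt
    have h2 : Continuous fun z : ℝ × Sph n => (z.1, (z.2 : Ambient n)) := by fun_prop
    exact (ContinuousAt.comp (f := fun z : ℝ × Sph n => (z.1, (z.2 : Ambient n))) h1
      h2.continuousAt).clm_apply continuousAt_const
  obtain ⟨C, hC⟩ := ((isCompact_Icc (a := (-1 : ℝ)) (b := 1)).prod
    (isCompact_univ (X := Sph n))).exists_bound_of_continuousOn hcont.continuousOn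
  have hm : ∀ t, Integrable (fun x : Sph n => R (t, (x : Ambient n)))
      (volume : Measure (Ambient n)).toSphere := fun t =>
    integrable_toSphere (g := fun y => R (t, y)) fun y hy =>
      ContinuousAt.comp (f := fun y => (t, y)) (hR (t, y) hy).continuousAt (by fun_prop)
  have h := hasDerivAt_integral_of_dominated_loc_of_deriv_le
    (μ := (volume : Measure (Ambient n)).toSphere) (bound := fun _ => C)
    (F := fun t (x : Sph n) => R (t, (x : Ambient n)))
    (F' := fun t (x : Sph n) => fderiv ℝ R (t, (x : Ambient n)) (1, 0))
    (Icc_mem_nhds (show (-1 : ℝ) < 0 by norm_num) (show (0 : ℝ) < 1 by norm_num))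
    (Filter.Eventually.of_forall fun t => (hm t).aestronglyMeasurable) (hm 0)
    (hcont.comp (Continuous.prodMk_right (0 : ℝ))).aestronglyMeasurable
    (Filter.Eventually.of_forall fun x t ht => hC (t, x) ⟨ht, mem_univ _⟩) (integrable_const C)
    (Filter.Eventually.of_forall fun x t _ => hd t x)
  have h1 : ∀ x : Sph n, fderiv ℝ R (0, (x : Ambient n)) (1, 0) = 0 := fun x =>
    (hd 0 x).unique (h0 x)
  simpa [h1] using h.2

lemma contDiffAt_fderiv_snd {G : Type*} [NormedAddCommGroup G] [NormedSpace ℝ G]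
    {u : ℝ × Ambient n → G} {z : ℝ × Ambient n} (hu : ContDiffAt ℝ ∞ u z) :
    ContDiffAt ℝ ∞ (fun z : ℝ × Ambient n => fderiv ℝ (fun w => u (z.1, w)) z.2) z := by
  refine ContDiffAt.fderiv (f := fun (z : ℝ × Ambient n) w => u (z.1, w)) (g := Prod.snd) (n := ∞)
    ?_ contDiffAt_snd (by norm_cast)
  exact ContDiffAt.comp (z, z.2) (g := u)
    (f := fun p : (ℝ × Ambient n) × Ambient n => (p.1.1, p.2)) hu
    (contDiff_fst.fst.prodMk contDiff_snd).contDiffAt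

/-- The Laplacian in the space variable of a jointly smooth family is jointly smooth. -/
lemma contDiffAt_laplacian_snd {u : ℝ × Ambient n → F} {z : ℝ × Ambient n}
    (hu : ContDiffAt ℝ ∞ u z) :
    ContDiffAt ℝ ∞ (fun z : ℝ × Ambient n => Δ (fun w => u (z.1, w)) z.2) z := by
  have h := contDiffAt_fderiv_snd (contDiffAt_fderiv_snd hu)
  simp_rw [laplacian_eq_sum_fderiv (stdOrthonormalBasis ℝ (Ambient n))]
  exact ContDiffAt.sum fun i _ => (h.clm_apply contDiffAt_const).clm_apply contDiffAt_const

end Parametric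

/-! ### A criterion for biharmonicity -/

section Criterion

variable {p q : ℕ}

lemma IsVariation.isSmooth {φ : Sph p → Sph q} {Φ : ℝ → Sph p → Sph q} (hΦ : IsVariation φ Φ)
    (t : ℝ) : IsSmooth (Φ t) :=
  hΦ.1.comp (contMDiff_const.prodMk contMDiff_id)

/-- Biharmonicity of a smooth map `φ` of constant energy density for which
`W = Δφ + c φ`, where `c = |dφ|²`, satisfies `ΔW = -c Δφ`.

Indeed, `|τ(φ_t)|² = |Δφ_t|² - ⟨Δφ_t, φ_t⟩²` for every variation. By Green's formula, the integral
of `⟨Δφ_t, W⟩ - ⟨φ_t, ΔW⟩` is zero for all `t`, and this function has the same derivative at `t = 0`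
as `|τ(φ_t)|² / 2`, at every point of the sphere. -/
theorem isBiharmonic_of_laplacian {φ : Sph p → Sph q} (hφ : IsSmooth φ) {c : ℝ}
    (hc : ∀ x : Sph p, ⟪Δ (ext φ) x, (φ x : Ambient q)⟫ = -c) {W : Sph p → Ambient q}
    (hWs : ContMDiff (𝓡 p) 𝓘(ℝ, Ambient q) ∞ W)
    (hW : ∀ x : Sph p, W x = Δ (ext φ) x + c • (φ x : Ambient q))
    (hΔW : ∀ x : Sph p, Δ (radialExt W) x = -c • Δ (ext φ) x) : IsBiharmonic φ := by
  refine ⟨hφ, fun Φ hΦ => ?_⟩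
  let u : ℝ × Ambient p → Ambient q := fun z => ext (Φ z.1) z.2
  let L : ℝ × Ambient p → Ambient q := fun z => Δ (fun w => u (z.1, w)) z.2
  let B : Ambient p → Ambient q := radialExt W
  have hu : ∀ z : ℝ × Ambient p, z.2 ≠ 0 → ContDiffAt ℝ ∞ u z := fun z hz =>
    contDiffAt_radialExt_family (W := fun t x => (Φ t x : Ambient q))
      (contMDiff_coe_Sph.comp hΦ.1) hz
  have hL : ∀ z : ℝ × Ambient p, z.2 ≠ 0 → ContDiffAt ℝ ∞ L z := fun z hz =>
    contDiffAt_laplacian_snd (hu z hz)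
  have hB : ∀ y : Ambient p, y ≠ 0 → ContDiffAt ℝ ∞ B y := fun y hy => contDiffAt_radialExt hWs hy
  have hB2 : ∀ z : ℝ × Ambient p, z.2 ≠ 0 → ContDiffAt ℝ ∞ (fun z : ℝ × Ambient p => B z.2) z :=
    fun z hz => (hB z.2 hz).comp z contDiffAt_snd
  have hΔB : ∀ z : ℝ × Ambient p, z.2 ≠ 0 → ContDiffAt ℝ ∞ (fun z : ℝ × Ambient p => Δ B z.2) z :=
    fun z hz => contDiffAt_laplacian_snd (u := fun z : ℝ × Ambient p => B z.2) (hB2 z hz)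
  have hLe : ∀ t y, L (t, y) = Δ (ext (Φ t)) y := fun t y => rfl
  let P : ℝ × Ambient p → ℝ := fun z => (1 / 2) * (‖L z‖ ^ 2 - ⟪L z, u z⟫ ^ 2)
  let Q : ℝ × Ambient p → ℝ := fun z => ⟪L z, B z.2⟫ - ⟪u z, Δ B z.2⟫
  have hP : ∀ z : ℝ × Ambient p, z.2 ≠ 0 → ContDiffAt ℝ 1 P z := fun z hz =>
    (contDiffAt_const.mul (((hL z hz).norm_sq ℝ).sub (((hL z hz).inner ℝ (hu z hz)).pow 2))).of_le
      (by norm_cast)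
  have hQ : ∀ z : ℝ × Ambient p, z.2 ≠ 0 → ContDiffAt ℝ 1 Q z := fun z hz =>
    (((hL z hz).inner ℝ (hB2 z hz)).sub ((hu z hz).inner ℝ (hΔB z hz))).of_le (by norm_cast)
  have hcont : ∀ {T : ℝ × Ambient p → ℝ}, (∀ z : ℝ × Ambient p, z.2 ≠ 0 → ContDiffAt ℝ 1 T z) →
      ∀ t, Integrable (fun x : Sph p => T (t, (x : Ambient p)))
        (volume : Measure (Ambient p)).toSphere := fun {T} hT t =>
    integrable_toSphere (g := fun y => T (t, y)) fun y hy =>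
      ContinuousAt.comp (f := fun y => (t, y)) (hT (t, y) hy).continuousAt (by fun_prop)
  have hE : ∀ t, bienergy (Φ t) = ∫ x : Sph p, (P (t, (x : Ambient p)) - Q (t, (x : Ambient p)))
      ∂(volume : Measure (Ambient p)).toSphere := by
    intro t
    have hQ0 : ∫ x : Sph p, Q (t, (x : Ambient p)) ∂(volume : Measure (Ambient p)).toSphere = 0 := by
      simp only [Q, hLe, u]
      exact integral_inner_laplacian_sub (A := ext (Φ t)) (B := B)
        (fun y hy => (hΦ.isSmooth t).contDiffAt_ext hy) hB (ext_smul _)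
        fun c hc y => radialExt_smul W hc y
    rw [integral_sub (hcont hP t) (hcont hQ t), hQ0, sub_zero, bienergy, ← integral_const_mul]
    refine integral_congr_ae (Filter.Eventually.of_forall fun x => ?_)
    simp only [norm_tension_sq (hΦ.isSmooth t), P, hLe, u, ext_coe]
  rw [funext hE]
  refine hasDerivAt_integral_toSphere_zero (R := fun z => P z - Q z)
    (fun z hz => (hP z hz).sub (hQ z hz)) fun x => ?_
  have hcurve : ∀ {T : ℝ × Ambient p → Ambient q},
      (∀ z : ℝ × Ambient p, z.2 ≠ 0 → ContDiffAt ℝ ∞ T z) →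
      ∃ T', HasDerivAt (fun t => T (t, (x : Ambient p))) T' 0 := fun {T} hT =>
    ⟨_, ((hT (0, x) x.coe_ne_zero).differentiableAt (by simp)).hasFDerivAt.comp_hasDerivAt (0 : ℝ)
      ((hasDerivAt_id (0 : ℝ)).prodMk (hasDerivAt_const (0 : ℝ) (x : Ambient p)))⟩
  obtain ⟨V, hV⟩ := hcurve hu
  obtain ⟨L', hL'⟩ := hcurve hL
  have hu0 : u (0, (x : Ambient p)) = φ x := by simp [u, hΦ.2]
  have hL0 : L (0, (x : Ambient p)) = Δ (ext φ) x := by rw [hLe, hΦ.2]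
  have hBx : B x = Δ (ext φ) x + c • (φ x : Ambient q) := by simp [B, hW]
  have hPQ := ((hL'.norm_sq.sub ((hL'.inner ℝ hV).pow 2)).const_mul (1 / 2)).sub
    ((hL'.inner ℝ (hasDerivAt_const (0 : ℝ) (B x))).sub
      (hV.inner ℝ (hasDerivAt_const (0 : ℝ) (Δ B x))))
  convert! hPQ using 1
  have hΔBx : Δ B x = -c • Δ (ext φ) x := hΔW x
  rw [hu0, hL0, hBx, hΔBx, hc x]
  simp only [inner_zero_right, inner_add_right, inner_smul_right, zero_add,
    real_inner_comm (Δ (ext φ) (x : Ambient p)) L', real_inner_comm (Δ (ext φ) (x : Ambient p)) V]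
  push_cast
  ring

end Criterion

/-! ### Maps into a parallel of the sphere -/

section Lift

variable {p q : ℕ}

/-- The inclusion `ℝ^(q+1) → ℝ^(q+2)`, `v ↦ (v, 0)`. -/
def incl (q : ℕ) : Ambient q →L[ℝ] Ambient (q + 1) :=
  LinearMap.toContinuousLinearMap
    { toFun := fun v => WithLp.toLp 2 (Fin.snoc (α := fun _ => ℝ) (fun i => v i) 0)
      map_add' := fun v w => by
        ext i
        refine Fin.lastCases ?_ (fun i => ?_) i <;> simp
      map_smul' := fun a v => by
        ext i
        refine Fin.lastCases ?_ (fun i => ?_) i <;> simp }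

/-- The north pole `(0, 1)` of `S^(q+1)`. -/
def pole (q : ℕ) : Ambient (q + 1) := EuclideanSpace.single (Fin.last (q + 1)) 1

lemma incl_castSucc (v : Ambient q) (i : Fin (q + 1)) : incl q v i.castSucc = v i := by
  simp [incl]

lemma incl_last (v : Ambient q) : incl q v (Fin.last (q + 1)) = 0 := by
  simp [incl]

lemma inner_incl_incl (v w : Ambient q) : ⟪incl q v, incl q w⟫ = ⟪v, w⟫ := by
  simp [PiLp.inner_apply, Fin.sum_univ_castSucc, incl_castSucc, incl_last]

lemma inner_incl_pole (v : Ambient q) : ⟪incl q v, pole q⟫ = 0 := by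
  simp [pole, EuclideanSpace.inner_single_right, incl_last]

lemma inner_pole_pole : ⟪pole q, pole q⟫ = 1 := by
  simp [pole]

lemma lift_coe (f : Sph p → Sph q) (x : Sph p) :
    (lift f x : Ambient (q + 1)) = (1 / √2) • incl q (f x) + (1 / √2) • pole q := by
  ext i
  refine Fin.lastCases ?_ (fun i => ?_) i
  · simp [lift, incl_last, pole]
  · simp [lift, incl_castSucc, pole, (Fin.castSucc_lt_last i).ne]

lemma isSmooth_lift {f : Sph p → Sph q} (hf : IsSmooth f) : IsSmooth (lift f) := by
  have := Fact.mk (finrank_euclideanSpace_fin (𝕜 := ℝ) (n := q + 1 + 1))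
  have h1 : ContMDiff (𝓡 p) 𝓘(ℝ, Ambient (q + 1)) ∞ fun x => (lift f x : Ambient (q + 1)) := by
    simp_rw [lift_coe]
    have h2 : ContDiff ℝ ∞ fun v : Ambient q => (1 / √2) • incl q v + (1 / √2) • pole q :=
      ((incl q).contDiff.const_smul _).add contDiff_const
    exact h2.contMDiff.comp (contMDiff_coe_Sph.comp hf)
  exact h1.codRestrict_sphere fun x => (lift f x).2

/-- The Laplacian of an affine function of a map into the sphere. -/
lemma laplacian_radialExt_affine {m : ℕ} {f : Sph p → Sph q} (hf : IsSmooth f)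
    (l : Ambient q →L[ℝ] Ambient m) (v : Ambient m) (x : Sph p) :
    Δ (radialExt fun y => l (f y) + v) (x : Ambient p) = l (Δ (ext f) x) := by
  have h1 : (radialExt fun y => l (f y) + v) =ᶠ[𝓝 (x : Ambient p)] (l ∘ ext f + fun _ => v) := by
    filter_upwards [isOpen_ne.mem_nhds x.coe_ne_zero] with y hy
    rw [radialExt_of_ne _ hy, Pi.add_apply, Function.comp_apply, ext, radialExt_of_ne _ hy]
  have h2 : ContDiffAt ℝ 2 (ext f) x := (hf.contDiffAt_ext x.coe_ne_zero).of_le (by norm_cast)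
  rw [(laplacian_congr_nhds h1).eq_of_nhds, ContDiffAt.laplacian_add
    (l.contDiff.contDiffAt.comp _ h2) contDiffAt_const, h2.laplacian_CLM_comp_left]
  simp

lemma laplacian_ext_lift {f : Sph p → Sph q} (hf : IsSmooth f) (x : Sph p) :
    Δ (ext (lift f)) x = (1 / √2) • incl q (Δ (ext f) x) := by
  have h := laplacian_radialExt_affine hf ((1 / √2) • incl q) ((1 / √2) • pole q) x
  rw [ext, funext (lift_coe f)]
  exact h

/-- Harmonic maps into the sphere are the solutions of `Δf = -|df|² f`. -/
lemma IsHarmonic.laplacian_ext {f : Sph p → Sph q} (hf : IsHarmonic f) (x : Sph p) :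
    Δ (ext f) x = -(2 * energyDensity f x) • (f x : Ambient q) := by
  have h := hf.2 x
  rw [tension_eq hf.1, tanProj_apply, real_inner_comm, inner_laplacian_ext hf.1, sub_eq_zero] at h
  exact h

/-- A smooth map on a sphere of positive dimension with vanishing energy density is constant. -/
lemma exists_eq_const_of_energyDensity_eq_zero (hp : 1 ≤ p) {f : Sph p → Sph q} (hf : IsSmooth f)
    (h : ∀ x, energyDensity f x = 0) : ∃ c, ∀ x, f x = c := by
  have h1 : ∀ x : Sph p, fderiv ℝ (ext f) x = 0 := by
    intro x
    obtain ⟨b, hb, hb'⟩ := exists_orthonormalBasis_option x (stdOrthonormalBasis ℝ (Tan x))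
    have h2 := h x
    rw [energyDensity, mul_eq_zero, or_iff_right (by norm_num),
      Finset.sum_eq_zero_iff_of_nonneg fun _ _ => by positivity] at h2
    refine ContinuousLinearMap.coe_injective (b.toBasis.ext ?_)
    rintro (_ | i)
    · simpa [hb] using fderiv_apply_self_of_const_rays (ext_smul f)
        ((hf.contDiffAt_ext x.coe_ne_zero).differentiableAt (by simp))
    · simpa [hb'] using! h2 i (Finset.mem_univ i)
  have h2 : EqOn (fderiv ℝ (ext f)) 0 {0}ᶜ := by
    intro y hy
    have hn : 0 < ‖y‖ := norm_pos_iff.2 hy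
    have h3 := fderiv_smul_of_const_rays (ext_smul f) (inv_pos.2 hn) y
    rw [h1 ⟨‖y‖⁻¹ • y, by simp [norm_smul, hn.ne']⟩] at h3
    simpa [hn.ne'] using h3.symm
  have h3 : 1 < Module.rank ℝ (Ambient p) := by
    rw [← Module.finrank_eq_rank, finrank_euclideanSpace_fin]
    exact_mod_cast Nat.lt_succ_of_le hp
  obtain ⟨a, ha⟩ := isOpen_compl_singleton.exists_is_const_of_fderiv_eq_zero
    (isConnected_compl_singleton_of_one_lt_rank h3 0).isPreconnected
    (fun y hy => ((hf.contDiffAt_ext hy).differentiableAt (by simp)).differentiableWithinAt) h2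
  let x₀ : Sph p := ⟨EuclideanSpace.single 0 1, by simp⟩
  refine ⟨f x₀, fun x => Subtype.ext ?_⟩
  rw [← ext_coe f x, ← ext_coe f x₀, ha _ x.coe_ne_zero, ha _ x₀.coe_ne_zero]

lemma isBiharmonic_lift {f : Sph p → Sph q} (hf : IsHarmonic f) {e : ℝ}
    (he : ∀ x, energyDensity f x = e) : IsBiharmonic (lift f) := by
  have h2 : (1 / √2) * (1 / √2) = 1 / 2 := by
    rw [div_mul_div_comm, one_mul, Real.mul_self_sqrt (by norm_num)]
  have hΔ : ∀ x : Sph p, Δ (ext f) x = -(2 * e) • (f x : Ambient q) := fun x => by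
    rw [hf.laplacian_ext, he]
  -- Half of the energy of `f` is lost in the passage to `lift f`, so that `|d(lift f)|² = e`.
  refine isBiharmonic_of_laplacian (c := e)
    (W := fun x => (-(e / √2) • incl q) (f x) + (e / √2) • pole q) (isSmooth_lift hf.1) ?_ ?_ ?_ ?_
  · intro x
    rw [laplacian_ext_lift hf.1, hΔ, lift_coe]
    simp only [map_smul, inner_smul_left, inner_smul_right, inner_add_right, inner_incl_incl,
      inner_incl_pole, inner_coe_self, conj_trivial]
    linear_combination (-(2 * e)) * h2
  · have h3 : ContDiff ℝ ∞ fun v : Ambient q => (-(e / √2) • incl q) v + (e / √2) • pole q :=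
      (-(e / √2) • incl q).contDiff.add contDiff_const
    exact h3.contMDiff.comp (contMDiff_coe_Sph.comp hf.1)
  · intro x
    rw [laplacian_ext_lift hf.1, hΔ, lift_coe, map_smul, smul_apply]
    module
  · intro x
    rw [laplacian_radialExt_affine hf.1, laplacian_ext_lift hf.1, smul_apply]
    module

lemma not_isHarmonic_lift (hp : 1 ≤ p) {f : Sph p → Sph q} (hf : IsHarmonic f)
    (hne : ¬ ∃ c, ∀ x, f x = c) : ¬ IsHarmonic (lift f) := by
  intro hF
  refine hne (exists_eq_const_of_energyDensity_eq_zero hp hf.1 fun x => ?_)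
  have h1 := hF.laplacian_ext x
  rw [laplacian_ext_lift hf.1, hf.laplacian_ext, lift_coe] at h1
  have h2 : (1 / √2 : ℝ) ≠ 0 := by positivity
  -- The last coordinate shows that the energy density of `lift f` is zero.
  have h3 := congrArg (fun v => ⟪v, pole q⟫) h1
  simp only [map_smul, inner_smul_left, inner_add_left, inner_incl_pole, inner_pole_pole,
    conj_trivial, mul_zero, zero_add, mul_one] at h3
  have h4 := (mul_eq_zero.1 h3.symm).resolve_right h2
  have h5 := congrArg (fun v => ⟪v, incl q (f x)⟫) h1
  simp only [h4, zero_smul, map_smul, inner_smul_left, inner_incl_incl, inner_coe_self,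
    inner_zero_left, conj_trivial, mul_one] at h5
  have h6 := (mul_eq_zero.1 h5).resolve_left h2
  linarith

end Lift

end SphereMap

end

theorem theorem2p10 (p q : ℕ) (hp : 1 ≤ p) (f : SphereMap.Sph p → SphereMap.Sph q)
    (hf : SphereMap.IsEigenmap f) (hne : ¬ ∃ c, ∀ x, f x = c) :
    SphereMap.IsProperBiharmonic (SphereMap.lift f) := by
  obtain ⟨hh, e, he⟩ := hf
  exact ⟨SphereMap.isBiharmonic_lift hh he, SphereMap.not_isHarmonic_lift hp hh hne⟩
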